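/- **Proposition (Linearization).** Let $G$ be a (finite-dimensional, real, smooth) Lie group with Lie algebra $\mathfrak g$, let $\mu$ be a left Haar measure on $G$, let $\Lambda$ be a Lebesgue measure on $\mathfrak g$ (any normalization), and let $F\subseteq G$ be a non-empty, relatively compact subset. For an open, relatively compact neighbourhood $U\subseteq G$ of $1$ put $$\delta_F(U):=\frac{\mu\big(\bigcap_{g\in F} gUg^{-1}\big)}{\mu(U)} .$$ For a neighbourhood basis $\mathcal V$ of $1$ consisting of open, relatively compact sets with $U=U^{-1}$, put $\delta_F(\mathcal V):=\liminf_{U\in\mathcal V}\delta_F(U)$ (the lower limit as $U\in\mathcal V$ shrinks to $1$), and let $\delta_F:=\sup_{\mathcal V}\delta_F(\mathcal V)$ be the supremum over all such bases. For a representation $(\pi,V)$ of $G$ on a finite-dimensional real vector space with Lebesgue measure $\Lambda$, and an open, relatively compact neighbourhood $U\subseteq V$ of $0$, put $$\delta^V_F(U):=\frac{\Lambda\big(\bigcap_{g\in F}\pi(g)(U)\big)}{\Lambda(U)} .$$ For a neighbourhood basis $\mathcal V$ of $0$ consisting of open, relatively compact sets with $U=-U$, put $\delta^V_F(\mathcal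 V):=\liminf_{U\in\mathcal V}\delta^V_F(U)$ (the lower limit as $U\in\mathcal V$ shrinks to $0$), and let $\delta^V_F:=\sup_{\mathcal V}\delta^V_F(\mathcal V)$ be the supremum over all such bases. (If an intersection is not measurable, its outer measure is meant.) Then, for the adjoint representation $\mathrm{Ad}\colon G\to \mathrm{GL}(\mathfrak g)$, $$\delta_F=\delta_F^{\mathfrak g}.$$ -/

import Mathlib

open Filter Topology MeasureTheory
open scoped ENNReal Manifold ContDiff Pointwise

noncomputable section

/-- A neighbourhood basis of the identity of `G` consisting of symmetric (`U⁻¹ = U`), open,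
relatively compact sets. -/
structure IsSymmOpenNhdsBasisOne {G : Type*} [Group G] [TopologicalSpace G]
    (𝒱 : Set (Set G)) : Prop where
  hasBasis : (𝓝 (1 : G)).HasBasis (fun U : Set G => U ∈ 𝒱) id
  isOpen : ∀ U ∈ 𝒱, IsOpen U
  inv_eq : ∀ U ∈ 𝒱, U⁻¹ = U
  isCompact_closure : ∀ U ∈ 𝒱, IsCompact (closure U)

/-- The ratio `μ (⋂_{g ∈ F} g U g⁻¹) / μ U`. -/
def groupDeltaSet {G : Type*} [Group G] [MeasurableSpace G] (μ : Measure G)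
    (F U : Set G) : ℝ≥0∞ :=
  μ (⋂ g ∈ F, (fun x => g * x * g⁻¹) '' U) / μ U

/-- `liminf_{U ∈ 𝒱} δ_F(U)`, where `U` ranges over the members of `𝒱` and shrinks to `1`. -/
def groupDeltaBasis {G : Type*} [Group G] [TopologicalSpace G] [MeasurableSpace G]
    (μ : Measure G) (F : Set G) (𝒱 : Set (Set G)) : ℝ≥0∞ :=
  liminf (groupDeltaSet μ F) ((𝓝 (1 : G)).smallSets ⊓ 𝓟 𝒱)

/-- The invariant `δ_F` of a group `G` with Haar measure `μ`. -/
def groupDelta {G : Type*} [Group G] [TopologicalSpace G] [MeasurableSpace G]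
    (μ : Measure G) (F : Set G) : ℝ≥0∞ :=
  ⨆ (𝒱 : Set (Set G)) (_ : IsSymmOpenNhdsBasisOne 𝒱), groupDeltaBasis μ F 𝒱

/-- A neighbourhood basis of `0 : V` consisting of symmetric (`-U = U`), open,
relatively compact sets. -/
structure IsSymmOpenNhdsBasisZero {V : Type*} [AddCommGroup V] [TopologicalSpace V]
    (𝒱 : Set (Set V)) : Prop where
  hasBasis : (𝓝 (0 : V)).HasBasis (fun U : Set V => U ∈ 𝒱) id
  isOpen : ∀ U ∈ 𝒱, IsOpen U
  neg_eq : ∀ U ∈ 𝒱, -U = U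
  isCompact_closure : ∀ U ∈ 𝒱, IsCompact (closure U)

/-- The ratio `Λ (⋂_{g ∈ F} π(g)(U)) / Λ U`. -/
def repDeltaSet {G V : Type*} [Group G] [AddCommGroup V] [Module ℝ V] [MeasurableSpace V]
    (Λ : Measure V) (π : Representation ℝ G V) (F : Set G) (U : Set V) : ℝ≥0∞ :=
  Λ (⋂ g ∈ F, π g '' U) / Λ U

/-- `liminf_{U ∈ 𝒱} δ^V_F(U)`, where `U` ranges over the members of `𝒱` and shrinks to `0`. -/
def repDeltaBasis {G V : Type*} [Group G] [AddCommGroup V] [Module ℝ V] [TopologicalSpace V]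
    [MeasurableSpace V] (Λ : Measure V) (π : Representation ℝ G V) (F : Set G)
    (𝒱 : Set (Set V)) : ℝ≥0∞ :=
  liminf (repDeltaSet Λ π F) ((𝓝 (0 : V)).smallSets ⊓ 𝓟 𝒱)

/-- The linearized invariant `δ^V_F` of a representation `π` of `G` on a finite-dimensional real
vector space `V` with Lebesgue measure `Λ`. -/
def repDelta {G V : Type*} [Group G] [AddCommGroup V] [Module ℝ V] [TopologicalSpace V]
    [MeasurableSpace V] (Λ : Measure V) (π : Representation ℝ G V) (F : Set G) : ℝ≥0∞ :=
  ⨆ (𝒱 : Set (Set V)) (_ : IsSymmOpenNhdsBasisZero 𝒱), repDeltaBasis Λ π F 𝒱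

section Adjoint

variable {E : Type*} [NormedAddCommGroup E] [NormedSpace ℝ E]
  {H : Type*} [TopologicalSpace H] (I : ModelWithCorners ℝ E H)
  {G : Type*} [Group G] [TopologicalSpace G] [ChartedSpace H G]

/-- `Ad_g`, the derivative at `1` of the conjugation `x ↦ g x g⁻¹`. The derivative takes its values
in the tangent space at `g 1 g⁻¹ = 1`. -/
def adjointMap (g : G) : GroupLieAlgebra I G →L[ℝ] GroupLieAlgebra I G :=
  (mfderiv I I (fun x : G => g * x * g⁻¹) (1 : G) : _)

theorem adjointMap_one : adjointMap I (1 : G) = ContinuousLinearMap.id ℝ _ := by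
  have h : (fun x : G => (1 : G) * x * (1 : G)⁻¹) = id := by ext x; simp
  unfold adjointMap
  rw [h]
  exact mfderiv_id

theorem adjointMap_mul [LieGroup I ∞ G] (g h : G) :
    adjointMap I (g * h) = (adjointMap I g).comp (adjointMap I h) := by
  have hc : (fun x : G => g * h * x * (g * h)⁻¹) =
      (fun x : G => g * x * g⁻¹) ∘ (fun x : G => h * x * h⁻¹) := by
    ext x; simp [mul_assoc]
  have hs (k : G) : ContMDiff I I ∞ (fun x : G => k * x * k⁻¹) :=
    (contMDiff_mul_right (I := I) (n := ∞) (a := k⁻¹)).comp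
      (contMDiff_mul_left (I := I) (n := ∞) (a := k))
  have hd (k x : G) : MDifferentiableAt I I (fun x : G => k * x * k⁻¹) x :=
    (hs k).mdifferentiableAt (by simp)
  have h1 : h * 1 * h⁻¹ = 1 := by simp
  unfold adjointMap
  rw [hc, mfderiv_comp (I' := I) (1 : G) (hd g _) (hd h 1)]
  rw [h1]
  rfl

/-- The adjoint representation of a Lie group on its Lie algebra. -/
def adjointRep [LieGroup I ∞ G] : Representation ℝ G (GroupLieAlgebra I G) where
  toFun g := (adjointMap I g).toLinearMap
  map_one' := by rw [adjointMap_one]; rfl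
  map_mul' g h := by rw [adjointMap_mul]; rfl

end Adjoint

end

/-! Suppose a chart `L` at the identity satisfies `L (g * x * g⁻¹) = Ad_g (L x)` for all `g ∈ F`,
satisfies `L x⁻¹ = -L x`, and carries Haar measure to a constant times Lebesgue measure up to a
factor `κ` on a neighbourhood depending on `κ > 1`. Small symmetric sets then correspond under `L`,
intersections of conjugates go to intersections of `Ad`-translates, and the two ratios differ by a
factor of at most `κ ^ 2`. Letting `κ → 1` gives equality
(`groupDelta_eq_repDelta_of_openPartialHomeomorph`). Compactness of `closure F` makes "near the
identity" uniform over `F`.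

The chart is a logarithm built without the exponential map. The local square root `ψ` has derivative
`1/2` at the fixed point, so `σ = lim 2 ^ n • ψ^[n]` exists near `0` and has strict derivative `1`.
A map `τ` that commutes with `ψ` satisfies `σ ∘ τ = T ∘ σ`, where `T` is the derivative of `τ` at
`0`. Conjugations and inversion respect squares, hence become linear (`exists_linearization`,
`exists_linearizing_chart`).

Haar measure is compared with Lebesgue measure as in the uniqueness proof for Haar measure: Fubini
on a set of pairs, with approximate invariance of Lebesgue measure under `b ↦ y * b⁻¹` in the chart
(`exists_nhds_haar_comparable`). -/

/-- A symmetric, open, relatively compact neighbourhood of `1`. -/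
structure IsSymmOpenNhdOne {G : Type*} [Group G] [TopologicalSpace G] (U : Set G) : Prop where
  one_mem : (1 : G) ∈ U
  isOpen : IsOpen U
  inv_eq : U⁻¹ = U
  isCompact_closure : IsCompact (closure U)

/-- A symmetric, open, relatively compact neighbourhood of `0`. -/
structure IsSymmOpenNhdZero {V : Type*} [AddCommGroup V] [TopologicalSpace V] (U : Set V) :
    Prop where
  zero_mem : (0 : V) ∈ U
  isOpen : IsOpen U
  neg_eq : -U = U
  isCompact_closure : IsCompact (closure U)

/-! ### Replacing suprema over bases by single small sets. -/

section Bases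

variable {G : Type*} [Group G] {F : Set G}

section Group

variable [TopologicalSpace G] [MeasurableSpace G] {μ : Measure G}

theorem exists_lt_groupDeltaSet_of_lt_groupDelta {k : ℝ≥0∞} (hk : k < groupDelta μ F)
    {W : Set G} (hW : W ∈ 𝓝 1) :
    ∃ U ⊆ W, IsSymmOpenNhdOne U ∧ k < groupDeltaSet μ F U := by
  obtain ⟨𝒱, h⟩ := lt_iSup_iff.1 hk
  obtain ⟨h𝒱, h⟩ := lt_iSup_iff.1 h
  have h' := eventually_lt_of_lt_liminf h
  rw [eventually_inf_principal, eventually_smallSets] at h'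
  obtain ⟨s, hs, h'⟩ := h'
  obtain ⟨U, hU, hUW⟩ := h𝒱.hasBasis.mem_iff.1 (inter_mem hW hs)
  exact ⟨U, fun x hx => (hUW hx).1, ⟨mem_of_mem_nhds (h𝒱.hasBasis.mem_of_mem hU), h𝒱.isOpen U hU,
    h𝒱.inv_eq U hU, h𝒱.isCompact_closure U hU⟩, h' U (fun x hx => (hUW hx).2) hU⟩

/-- All symmetric open relatively compact neighbourhoods with ratio at least `k` together form one
admissible basis. -/
theorem le_groupDelta {k : ℝ≥0∞}
    (h : ∀ W ∈ 𝓝 (1 : G), ∃ U ⊆ W, IsSymmOpenNhdOne U ∧ k ≤ groupDeltaSet μ F U) :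
    k ≤ groupDelta μ F := by
  have h𝒱 : IsSymmOpenNhdsBasisOne {U : Set G | IsSymmOpenNhdOne U ∧ k ≤ groupDeltaSet μ F U} :=
    { hasBasis := ⟨fun W => ⟨fun hW => by
          obtain ⟨U, hUW, hU⟩ := h W hW
          exact ⟨U, hU, hUW⟩,
        fun ⟨U, hU, hUW⟩ => mem_of_superset (hU.1.isOpen.mem_nhds hU.1.one_mem) hUW⟩⟩
      isOpen := fun U hU => hU.1.isOpen
      inv_eq := fun U hU => hU.1.inv_eq
      isCompact_closure := fun U hU => hU.1.isCompact_closure }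
  refine le_iSup₂_of_le _ h𝒱 (le_liminf_of_le (by isBoundedDefault) ?_)
  rw [eventually_inf_principal]
  exact Eventually.of_forall fun U hU => hU.2

end Group

variable {V : Type*} [AddCommGroup V] [Module ℝ V] [TopologicalSpace V] [MeasurableSpace V]
  {Λ : Measure V} {π : Representation ℝ G V}

theorem exists_lt_repDeltaSet_of_lt_repDelta {k : ℝ≥0∞} (hk : k < repDelta Λ π F)
    {W : Set V} (hW : W ∈ 𝓝 0) :
    ∃ U ⊆ W, IsSymmOpenNhdZero U ∧ k < repDeltaSet Λ π F U := by
  obtain ⟨𝒱, h⟩ := lt_iSup_iff.1 hk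
  obtain ⟨h𝒱, h⟩ := lt_iSup_iff.1 h
  have h' := eventually_lt_of_lt_liminf h
  rw [eventually_inf_principal, eventually_smallSets] at h'
  obtain ⟨s, hs, h'⟩ := h'
  obtain ⟨U, hU, hUW⟩ := h𝒱.hasBasis.mem_iff.1 (inter_mem hW hs)
  exact ⟨U, fun x hx => (hUW hx).1, ⟨mem_of_mem_nhds (h𝒱.hasBasis.mem_of_mem hU), h𝒱.isOpen U hU,
    h𝒱.neg_eq U hU, h𝒱.isCompact_closure U hU⟩, h' U (fun x hx => (hUW hx).2) hU⟩

theorem le_repDelta {k : ℝ≥0∞}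
    (h : ∀ W ∈ 𝓝 (0 : V), ∃ U ⊆ W, IsSymmOpenNhdZero U ∧ k ≤ repDeltaSet Λ π F U) :
    k ≤ repDelta Λ π F := by
  have h𝒱 : IsSymmOpenNhdsBasisZero {U : Set V | IsSymmOpenNhdZero U ∧ k ≤ repDeltaSet Λ π F U} :=
    { hasBasis := ⟨fun W => ⟨fun hW => by
          obtain ⟨U, hUW, hU⟩ := h W hW
          exact ⟨U, hU, hUW⟩,
        fun ⟨U, hU, hUW⟩ => mem_of_superset (hU.1.isOpen.mem_nhds hU.1.zero_mem) hUW⟩⟩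
      isOpen := fun U hU => hU.1.isOpen
      neg_eq := fun U hU => hU.1.neg_eq
      isCompact_closure := fun U hU => hU.1.isCompact_closure }
  refine le_iSup₂_of_le _ h𝒱 (le_liminf_of_le (by isBoundedDefault) ?_)
  rw [eventually_inf_principal]
  exact Eventually.of_forall fun U hU => hU.2

end Bases

/-! ### Transfer of the invariants through an equivariant chart. -/

section Transfer

theorem ENNReal.div_le_mul_div_of_comparable {a a' u u' c κ : ℝ≥0∞} (hc : c ≠ 0) (hc' : c ≠ ⊤)
    (hκ : κ ≠ 0) (hκ' : κ ≠ ⊤) (ha : a ≤ κ * (c * a')) (hu : c * u' ≤ κ * u) :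
    a / u ≤ κ ^ 2 * (a' / u') := by
  have h1 : u⁻¹ ≤ κ * (c * u')⁻¹ := by
    have := ENNReal.inv_le_inv.2 hu
    rw [ENNReal.mul_inv (Or.inl hκ) (Or.inl hκ')] at this
    calc u⁻¹ = κ * (κ⁻¹ * u⁻¹) := by rw [← mul_assoc, ENNReal.mul_inv_cancel hκ hκ', one_mul]
      _ ≤ _ := by gcongr
  rw [ENNReal.mul_inv (Or.inl hc) (Or.inl hc')] at h1
  calc a / u = a * u⁻¹ := rfl
    _ ≤ (κ * (c * a')) * (κ * (c⁻¹ * u'⁻¹)) := by gcongr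
    _ = κ ^ 2 * ((c * c⁻¹) * (a' * u'⁻¹)) := by ring
    _ = κ ^ 2 * (a' / u') := by rw [ENNReal.mul_inv_cancel hc hc', one_mul]; rfl

variable {G : Type*} [Group G] [TopologicalSpace G]
  {V : Type*} [NormedAddCommGroup V] [NormedSpace ℝ V]

/-- An image commutes with a nonempty intersection when the map is injective on the union of the
sets; this is why every conjugate of `U` must stay in the source. -/
theorem image_iInter_conj_eq {F : Set G} (hne : F.Nonempty) {π : Representation ℝ G V}
    {L : OpenPartialHomeomorph G V} {U : Set G}
    (hs : ∀ x ∈ U, ∀ g ∈ F, g * x * g⁻¹ ∈ L.source)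
    (he : ∀ x ∈ U, ∀ g ∈ F, L (g * x * g⁻¹) = π g (L x)) :
    L '' (⋂ g ∈ F, (fun x => g * x * g⁻¹) '' U) = ⋂ g ∈ F, π g '' (L '' U) := by
  rw [Set.InjOn.image_biInter_eq hne]
  · refine Set.iInter₂_congr fun g hg => ?_
    rw [Set.image_image, Set.image_image]
    exact Set.image_congr fun x hx => he x hx g hg
  · refine L.injOn.mono ?_
    intro y hy
    obtain ⟨g, hg, hy⟩ := Set.mem_iUnion₂.1 hy
    obtain ⟨x, hx, rfl⟩ := hy
    exact hs x hx g hg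

/-- The invariants `δ_F` of a group and of a representation agree, as soon as there is an
equivariant local homeomorphism which almost preserves the measures near the identity. -/
theorem groupDelta_eq_repDelta_of_openPartialHomeomorph [IsTopologicalGroup G]
    [MeasurableSpace G] [FiniteDimensional ℝ V] [MeasurableSpace V] {μ : Measure G} {Λ : Measure V}
    {F : Set G} (hne : F.Nonempty) {π : Representation ℝ G V} (L : OpenPartialHomeomorph G V)
    (h1 : (1 : G) ∈ L.source) (hL1 : L 1 = 0)
    (hinv : ∀ᶠ x in 𝓝 (1 : G), L x⁻¹ = - L x)
    (hconj : ∀ N ∈ 𝓝 (1 : G), ∀ᶠ x in 𝓝 (1 : G), ∀ g ∈ F, g * x * g⁻¹ ∈ N)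
    (hequiv : ∀ᶠ x in 𝓝 (1 : G), ∀ g ∈ F, L (g * x * g⁻¹) = π g (L x))
    (hmeas : ∀ κ : ℝ≥0∞, 1 < κ → κ ≠ ⊤ → ∃ c : ℝ≥0∞, c ≠ 0 ∧ c ≠ ⊤ ∧ ∃ W ∈ 𝓝 (1 : G),
      ∀ A ⊆ W, μ A ≤ κ * (c * Λ (L '' A)) ∧ c * Λ (L '' A) ≤ κ * μ A) :
    groupDelta μ F = repDelta Λ π F := by
  have hinv_cont : Tendsto (fun x : G => x⁻¹) (𝓝 1) (𝓝 1) := by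
    simpa using (continuous_inv (G := G)).tendsto 1
  have key : ∀ κ : ℝ≥0∞, 1 < κ → κ ≠ ⊤ → ∃ W ∈ 𝓝 (1 : G), W ⊆ L.source ∧
      (∀ x ∈ W, x⁻¹ ∈ L.source ∧ L x⁻¹ = - L x) ∧ ∀ U ⊆ W,
        groupDeltaSet μ F U ≤ κ ^ 2 * repDeltaSet Λ π F (L '' U) ∧
        repDeltaSet Λ π F (L '' U) ≤ κ ^ 2 * groupDeltaSet μ F U := by
    intro κ hκ hκ'
    obtain ⟨c, hc, hc', W, hW, hWm⟩ := hmeas κ hκ hκ'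
    have hs : L.source ∈ 𝓝 (1 : G) := L.open_source.mem_nhds h1
    have hall : ∀ᶠ x in 𝓝 (1 : G), x ∈ W ∧ x ∈ L.source ∧ (x⁻¹ ∈ L.source ∧ L x⁻¹ = - L x) ∧
        (∀ g ∈ F, g * x * g⁻¹ ∈ W ∩ L.source) ∧ ∀ g ∈ F, L (g * x * g⁻¹) = π g (L x) :=
      (eventually_mem_set.2 hW).and ((eventually_mem_set.2 hs).and
        (((hinv_cont.eventually (eventually_mem_set.2 hs)).and hinv).and
          ((hconj _ (inter_mem hW hs)).and hequiv)))
    refine ⟨_, hall, fun x hx => hx.2.1, fun x hx => hx.2.2.1, fun U hU => ?_⟩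
    have him := image_iInter_conj_eq hne (π := π) (L := L) (U := U)
      (fun x hx g hg => ((hU hx).2.2.2.1 g hg).2) (fun x hx g hg => (hU hx).2.2.2.2 g hg)
    have hA : (⋂ g ∈ F, (fun x => g * x * g⁻¹) '' U) ⊆ W := by
      intro y hy
      obtain ⟨g, hg⟩ := hne
      obtain ⟨x, hx, rfl⟩ := Set.mem_iInter₂.1 hy g hg
      exact ((hU hx).2.2.2.1 g hg).1
    have hU' : U ⊆ W := fun x hx => (hU hx).1
    have hκ0 : κ ≠ 0 := (zero_lt_one.trans hκ).ne'
    unfold groupDeltaSet repDeltaSet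
    rw [← him]
    refine ⟨ENNReal.div_le_mul_div_of_comparable hc hc' hκ0 hκ' (hWm _ hA).1 (hWm _ hU').2, ?_⟩
    -- Exchanging the roles of `μ` and `Λ` inverts the proportionality constant.
    refine ENNReal.div_le_mul_div_of_comparable (c := c⁻¹) (by simpa) (by simpa) hκ0 hκ' ?_ ?_
    · calc _ = c⁻¹ * (c * Λ (L '' ⋂ g ∈ F, (fun x => g * x * g⁻¹) '' U)) := by
            rw [← mul_assoc, ENNReal.inv_mul_cancel hc hc', one_mul]
        _ ≤ c⁻¹ * (κ * μ (⋂ g ∈ F, (fun x => g * x * g⁻¹) '' U)) :=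
            mul_le_mul_right (hWm _ hA).2 _
        _ = _ := by ring
    · calc _ ≤ c⁻¹ * (κ * (c * Λ (L '' U))) := by gcongr; exact (hWm _ hU').1
        _ = κ * ((c⁻¹ * c) * Λ (L '' U)) := by ring
        _ = _ := by rw [ENNReal.inv_mul_cancel hc hc', one_mul]
  have hlim : ∀ a b : ℝ≥0∞, (∀ κ : ℝ≥0∞, 1 < κ → κ ≠ ⊤ → a ≤ κ ^ 2 * b) → a ≤ b := by
    intro a b h
    refine le_of_forall_gt_imp_ge_of_dense fun d hd => ?_
    have hcont : Tendsto (fun κ : ℝ≥0∞ => κ ^ 2 * b) (𝓝 1) (𝓝 (1 ^ 2 * b)) := by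
      refine ENNReal.Tendsto.mul_const ((ENNReal.continuous_pow 2).tendsto 1) (Or.inl (by simp))
    rw [one_pow, one_mul] at hcont
    have h2 := ((hcont.eventually (gt_mem_nhds hd)).filter_mono
      (nhdsWithin_le_nhds (s := Set.Ioi 1))).and
      (Ioo_mem_nhdsGT (show (1 : ℝ≥0∞) < 2 from ENNReal.one_lt_two))
    obtain ⟨κ, hκ1, hκ2, hκ3⟩ := h2.exists
    exact (h κ hκ2 (hκ3.trans (by simp)).ne).trans hκ1.le
  refine le_antisymm (hlim _ _ fun κ hκ hκ' => ?_) (hlim _ _ fun κ hκ hκ' => ?_)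
  all_goals
    obtain ⟨W, hW, hWs, hWi, hWd⟩ := key κ hκ hκ'
    have hκ0 : κ ^ 2 ≠ 0 := pow_ne_zero _ (zero_lt_one.trans hκ).ne'
    have hκ2 : κ ^ 2 ≠ ⊤ := ENNReal.pow_ne_top hκ'
    refine le_of_forall_lt_imp_le_of_dense fun k hk => ?_
    have hdiv : ∀ x y : ℝ≥0∞, x / κ ^ 2 ≤ y ↔ x ≤ κ ^ 2 * y := fun x y => by
      rw [ENNReal.div_le_iff_le_mul (Or.inl hκ0) (Or.inl hκ2), mul_comm]
    rw [← hdiv]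
  · refine le_repDelta fun W' hW' => ?_
    rw [← hL1] at hW'
    -- The compact neighbourhood `K` makes the transported set `L '' U` relatively compact.
    obtain ⟨K, hK, hKW', hKc⟩ := LocallyCompactSpace.local_compact_nhds _ _ hW'
    obtain ⟨U, hUW, hU, hkU⟩ := exists_lt_groupDeltaSet_of_lt_groupDelta hk
      (inter_mem hW ((L.continuousAt h1).preimage_mem_nhds hK))
    have hUK : L '' U ⊆ K := Set.image_subset_iff.2 fun x hx => (hUW hx).2
    refine ⟨L '' U, hUK.trans hKW', ⟨⟨1, hU.one_mem, hL1⟩,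
      L.isOpen_image_of_subset_source hU.isOpen fun x hx => hWs (hUW hx).1, ?_,
      hKc.closure_of_subset hUK⟩, ?_⟩
    · have hsub : ∀ y ∈ L '' U, -y ∈ L '' U := by
        rintro _ ⟨x, hx, rfl⟩
        exact ⟨x⁻¹, by rw [← hU.inv_eq]; simpa using hx, (hWi x (hUW hx).1).2⟩
      ext y
      exact ⟨fun hy => by simpa using hsub _ hy, fun hy => hsub _ hy⟩
    · rw [hdiv]
      exact hkU.le.trans (hWd U fun x hx => (hUW hx).1).1
  · refine le_groupDelta fun W' hW' => ?_
    have h0 : (0 : V) ∈ L.target := hL1 ▸ L.map_source h1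
    have hLs : L.symm 0 = 1 := by rw [← hL1, L.left_inv h1]
    have hWW' : L.symm ⁻¹' (W ∩ W') ∈ 𝓝 (0 : V) :=
      (L.continuousAt_symm h0).preimage_mem_nhds (hLs ▸ inter_mem hW hW')
    obtain ⟨K, hK, hKt, hKc⟩ := LocallyCompactSpace.local_compact_nhds _ _
      (inter_mem (L.open_target.mem_nhds h0) hWW')
    obtain ⟨U, hUK, hU, hkU⟩ := exists_lt_repDeltaSet_of_lt_repDelta hk hK
    have hUt : U ⊆ L.target := fun x hx => (hKt (hUK hx)).1
    have hUW : L.symm '' U ⊆ W := Set.image_subset_iff.2 fun x hx => (hKt (hUK hx)).2.1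
    have himage : L '' (L.symm '' U) = U := by
      rw [Set.image_image]
      exact (Set.image_congr fun x hx => L.right_inv (hUt hx)).trans (Set.image_id' U)
    refine ⟨L.symm '' U, Set.image_subset_iff.2 fun x hx => (hKt (hUK hx)).2.2,
      ⟨⟨0, hU.zero_mem, hLs⟩, L.symm.isOpen_image_of_subset_source hU.isOpen hUt, ?_,
      (hKc.image_of_continuousOn (L.continuousOn_symm.mono fun x hx => (hKt hx).1)).closure_of_subset
        (Set.image_mono hUK)⟩, ?_⟩
    · have hsub : ∀ x ∈ L.symm '' U, x⁻¹ ∈ L.symm '' U := by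
        intro x hx
        obtain ⟨hx1, hx2⟩ := hWi x (hUW hx)
        obtain ⟨u, hu, rfl⟩ := hx
        rw [L.right_inv (hUt hu)] at hx2
        exact ⟨-u, by rw [← hU.neg_eq]; simpa using hu, by rw [← hx2, L.left_inv hx1]⟩
      ext y
      exact ⟨fun hy => by simpa using hsub _ hy, fun hy => hsub _ hy⟩
    · rw [hdiv]
      refine hkU.le.trans ?_
      have := (hWd _ hUW).2
      rwa [himage] at this

end Transfer

/-! ### Haar measure against Lebesgue measure in a chart. -/

section MeasureComparison

theorem ContinuousOn.measurableSet_inter_preimage {X Y : Type*} [TopologicalSpace X]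
    [MeasurableSpace X] [OpensMeasurableSpace X] [TopologicalSpace Y] [MeasurableSpace Y]
    [BorelSpace Y] {f : X → Y} {s : Set X} {t : Set Y} (hf : ContinuousOn f s)
    (hs : MeasurableSet s) (ht : MeasurableSet t) : MeasurableSet (s ∩ f ⁻¹' t) := by
  have h : MeasurableSet (s.domRestrict f ⁻¹' t) :=
    (continuousOn_iff_continuous_domRestrict.1 hf).measurable ht
  have := hs.subtype_image h
  convert this using 1
  ext x
  exact ⟨fun hx => ⟨⟨x, hx.1⟩, hx.2, rfl⟩, fun ⟨y, hy, hyx⟩ => hyx ▸ ⟨y.2, hy⟩⟩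

theorem ContinuousLinearMap.abs_det_neg_id {V : Type*} [NormedAddCommGroup V] [NormedSpace ℝ V] :
    |(-ContinuousLinearMap.id ℝ V).det| = 1 := by
  have h : (-ContinuousLinearMap.id ℝ V).toLinearMap = (-1 : ℝ) • LinearMap.id := by
    ext; simp
  rw [ContinuousLinearMap.det, h, LinearMap.det_smul]
  simp

theorem ENNReal.exists_one_lt_sq_le {κ : ℝ≥0∞} (hκ : 1 < κ) (hκ' : κ ≠ ⊤) :
    ∃ m : ℝ≥0∞, 1 < m ∧ m ≠ ⊤ ∧ m ^ 2 = κ :=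
  ⟨κ ^ (2⁻¹ : ℝ), ENNReal.one_lt_rpow hκ (by norm_num),
    ENNReal.rpow_ne_top_of_nonneg (by norm_num) hκ', by
      rw [← ENNReal.rpow_natCast, ← ENNReal.rpow_mul]; norm_num⟩

/-- A monotone function has only countably many discontinuities, so a continuity point `r` exists
below `R`; nearby radii on both sides then serve. -/
theorem Monotone.exists_lt_lt_comparable {f : ℝ → ℝ≥0∞} (hf : Monotone f) {R : ℝ} (hR : 0 < R)
    (hpos : ∀ t, 0 < t → f t ≠ 0) (hfin : f R ≠ ⊤) {κ : ℝ≥0∞} (hκ : 1 < κ) :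
    ∃ r₁ r r₂ : ℝ, 0 < r₁ ∧ r₁ < r ∧ r < r₂ ∧ r₂ ≤ R ∧ f r₂ ≤ κ * f r ∧ f r ≤ κ * f r₁ := by
  obtain ⟨r, hr, hr0, hrR⟩ := (hf.countable_not_continuousAt.dense_compl ℝ).exists_between hR
  simp only [Set.mem_compl_iff, Set.mem_ofPred_eq, not_not] at hr
  have hr' : f r ≠ 0 := hpos r hr0
  have hrt : f r ≠ ⊤ := ne_top_of_le_ne_top hfin (hf hrR.le)
  have h1 : f r < κ * f r := by
    simpa using (ENNReal.mul_lt_mul_iff_left hr' hrt).2 hκ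
  have h2 : Tendsto (fun t => κ * f t) (𝓝 r) (𝓝 (κ * f r)) :=
    ENNReal.Tendsto.const_mul hr (Or.inl hr')
  have e1 := (hr.tendsto.eventually (gt_mem_nhds h1)).filter_mono
    (nhdsWithin_le_nhds (s := Set.Ioi r))
  have e2 := (h2.eventually (lt_mem_nhds h1)).filter_mono (nhdsWithin_le_nhds (s := Set.Iio r))
  obtain ⟨r₂, h₂, h₂'⟩ := (e1.and (Ioo_mem_nhdsGT hrR)).exists
  obtain ⟨r₁, h₁, h₁'⟩ := (e2.and (Ioo_mem_nhdsLT hr0)).exists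
  exact ⟨r₁, r, r₂, h₁'.1, h₁'.2, h₂'.1, h₂'.2.le, h₂.le, h₁.le⟩

variable {G : Type*} [Group G] [TopologicalSpace G]
  {V : Type*} [NormedAddCommGroup V] [NormedSpace ℝ V] [FiniteDimensional ℝ V]
  [MeasurableSpace V] [BorelSpace V] {Λ : Measure V} [Λ.IsAddHaarMeasure]
  {L : OpenPartialHomeomorph G V}

/-- In the chart `b ↦ y * b⁻¹` is uniformly close to an affine map with linear part `-id`, whose
determinant has absolute value `1`. Strict differentiability in both variables makes the
neighbourhood independent of `y`. -/
theorem exists_nhds_addHaar_image_mul_inv_comparable (h1 : (1 : G) ∈ L.source) (hL1 : L 1 = 0)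
    (hL : HasStrictFDerivAt (fun p : V × V => L (L.symm p.1 * (L.symm p.2)⁻¹))
      (ContinuousLinearMap.fst ℝ V V - ContinuousLinearMap.snd ℝ V V) 0)
    {κ : ℝ≥0∞} (hκ : 1 < κ) (hκ' : κ ≠ ⊤) :
    ∃ P ∈ 𝓝 (1 : G), P ⊆ L.source ∧ ∀ y ∈ P, ∀ B ⊆ P,
      Λ (L '' ((fun b => y * b⁻¹) '' B)) ≤ κ * Λ (L '' B) ∧
      Λ (L '' B) ≤ κ * Λ (L '' ((fun b => y * b⁻¹) '' B)) := by
  lift κ to NNReal using hκ'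
  have hκ1 : (1 : NNReal) < κ := by exact_mod_cast hκ
  have hκ0 : κ ≠ 0 := (zero_lt_one.trans hκ1).ne'
  have hdet := ContinuousLinearMap.abs_det_neg_id (V := V)
  have e1 := addHaar_image_le_mul_of_det_lt Λ (-ContinuousLinearMap.id ℝ V) (m := κ)
    (by rw [hdet]; simpa using hκ)
  have e2 := mul_le_addHaar_image_of_lt_det Λ (-ContinuousLinearMap.id ℝ V) (m := κ⁻¹)
    (by rw [hdet]; simpa using inv_lt_one_of_one_lt₀ hκ1)
  obtain ⟨δ, ⟨hδ1, hδ2⟩, hδ⟩ := ((e1.and e2).and self_mem_nhdsWithin).exists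
  obtain ⟨S, hS, hSδ⟩ := hL.approximates_deriv_on_nhds (Or.inr hδ)
  obtain ⟨s, hs, t, ht, hst⟩ := mem_nhds_prod_iff.1 hS
  have hs' : L ⁻¹' (s ∩ t) ∈ 𝓝 (1 : G) :=
    (L.continuousAt h1).preimage_mem_nhds (by rw [hL1]; exact inter_mem hs ht)
  refine ⟨L.source ∩ L ⁻¹' (s ∩ t), inter_mem (L.open_source.mem_nhds h1) hs',
    Set.inter_subset_left, fun y hy B hB => ?_⟩
  have happ : ApproximatesLinearOn (fun v => L (y * (L.symm v)⁻¹)) (-ContinuousLinearMap.id ℝ V)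
      (L '' B) δ := by
    rintro _ ⟨b, hb, rfl⟩ _ ⟨b', hb', rfl⟩
    -- Freezing the first coordinate at `L y` leaves only the `-snd` part of the derivative.
    have := hSδ (L y, L b) (hst ⟨hy.2.1, (hB hb).2.2⟩) (L y, L b') (hst ⟨hy.2.1, (hB hb').2.2⟩)
    simpa [L.left_inv hy.1, Prod.norm_def] using this
  have him : (fun v => L (y * (L.symm v)⁻¹)) '' (L '' B) = L '' ((fun b => y * b⁻¹) '' B) := by
    rw [Set.image_image, Set.image_image]
    exact Set.image_congr fun b hb => by rw [L.left_inv (hB hb).1]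
  have i1 := hδ1 _ _ happ
  have i2 := hδ2 _ _ happ
  rw [him] at i1 i2
  refine ⟨i1, ?_⟩
  calc Λ (L '' B) = κ * ((κ⁻¹ : NNReal) * Λ (L '' B)) := by
        rw [← mul_assoc, ← ENNReal.coe_mul, mul_inv_cancel₀ hκ0, ENNReal.coe_one, one_mul]
    _ ≤ _ := by gcongr

/-- Compute the measure of the pairs `(x, y)` with `x` in a ball and `(L.symm x)⁻¹ * y ∈ B` in two
ways. The slices over `x` are left translates of `B`; those over `y` lie in `L (y B⁻¹)`, of Lebesgue
measure close to that of `L '' B`. Radii `r₁ < r < r₂` absorb the boundary effects. -/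
theorem exists_nhds_haar_comparable_measurableSet [IsTopologicalGroup G]
    [MeasurableSpace G] [BorelSpace G]
    {μ : Measure G} [μ.IsHaarMeasure]
    (h1 : (1 : G) ∈ L.source) (hL1 : L 1 = 0)
    (hL : HasStrictFDerivAt (fun p : V × V => L (L.symm p.1 * (L.symm p.2)⁻¹))
      (ContinuousLinearMap.fst ℝ V V - ContinuousLinearMap.snd ℝ V V) 0)
    {κ : ℝ≥0∞} (hκ : 1 < κ) (hκ' : κ ≠ ⊤) :
    ∃ c : ℝ≥0∞, c ≠ 0 ∧ c ≠ ⊤ ∧ ∃ W ∈ 𝓝 (1 : G), ∀ B ⊆ W, MeasurableSet B →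
      μ B ≤ κ ^ 2 * (c * Λ (L '' B)) ∧ c * Λ (L '' B) ≤ κ ^ 2 * μ B := by
  obtain ⟨P, hP, hPs, hPκ⟩ := exists_nhds_addHaar_image_mul_inv_comparable (Λ := Λ) h1 hL1 hL hκ hκ'
  have h0 : (0 : V) ∈ L.target := hL1 ▸ L.map_source h1
  have hLs : L.symm 0 = 1 := by rw [← hL1, L.left_inv h1]
  have hPt : L.target ∩ L.symm ⁻¹' P ∈ 𝓝 (0 : V) := inter_mem (L.open_target.mem_nhds h0)
    ((L.continuousAt_symm h0).preimage_mem_nhds (hLs ▸ hP))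
  obtain ⟨R, hR, hRt⟩ := Metric.nhds_basis_closedBall.mem_iff.1 hPt
  have hcomp : ∀ t ≤ R, IsCompact (L.symm '' Metric.closedBall 0 t) := fun t ht =>
    (isCompact_closedBall 0 t).image_of_continuousOn (L.continuousOn_symm.mono
      fun x hx => (hRt (Metric.closedBall_subset_closedBall ht hx)).1)
  have hball : ∀ t ≤ R, Metric.ball (0 : V) t ⊆ L.target := fun t ht x hx =>
    (hRt (Metric.closedBall_subset_closedBall ht (Metric.ball_subset_closedBall hx))).1
  have hopen : ∀ t ≤ R, IsOpen (L.symm '' Metric.ball 0 t) := fun t ht =>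
    L.symm.isOpen_image_of_subset_source Metric.isOpen_ball (hball t ht)
  have hmono : Monotone fun t => μ (L.symm '' Metric.ball 0 t) := fun s t hst =>
    measure_mono (Set.image_mono (Metric.ball_subset_ball hst))
  obtain ⟨r₁, r, r₂, hr₁, hr₁r, hrr₂, hr₂, hκ₂, hκ₁⟩ := hmono.exists_lt_lt_comparable hR
    -- Openness of the image is known only for radii up to `R`, so larger `t` are cut down to `min t
    -- R`.
    (fun t ht => ne_of_gt <| lt_of_lt_of_le
      ((hopen (min t R) (min_le_right _ _)).measure_pos μ
        ⟨_, Set.mem_image_of_mem _ (Metric.mem_ball_self (lt_min ht hR))⟩)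
      (hmono (min_le_left t R)))
    (ne_top_of_le_ne_top (hcomp R le_rfl).measure_lt_top.ne
      (measure_mono (Set.image_mono Metric.ball_subset_closedBall))) hκ
  have hrR : r ≤ R := hrr₂.le.trans hr₂
  have hr₁R : r₁ ≤ R := hr₁r.le.trans hrR
  have hr : 0 < r := hr₁.trans hr₁r
  obtain ⟨N₁, hN₁, hN₁s⟩ := compact_open_separated_mul_right (hcomp r₁ hr₁R) (hopen r hrR)
    (Set.image_mono (Metric.closedBall_subset_ball hr₁r))
  obtain ⟨N₂, hN₂, hN₂s⟩ := compact_open_separated_mul_right (hcomp r hrR) (hopen r₂ hr₂)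
    (Set.image_mono (Metric.closedBall_subset_ball hrr₂))
  have hN₁' : N₁⁻¹ ∈ 𝓝 (1 : G) := inv_mem_nhds_one G hN₁
  have hC0 : Λ (Metric.ball 0 r) ≠ 0 := (Metric.measure_ball_pos Λ 0 hr).ne'
  have hCt : Λ (Metric.ball 0 r) ≠ ⊤ := measure_ball_lt_top.ne
  set f : ℝ → ℝ≥0∞ := fun t => μ (L.symm '' Metric.ball 0 t) with hf
  have hfr0 : f r ≠ 0 := ((hopen r hrR).measure_pos μ
    ⟨_, Set.mem_image_of_mem _ (Metric.mem_ball_self hr)⟩).ne'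
  have hfr₂ : f r₂ ≠ ⊤ := ne_top_of_le_ne_top (hcomp r₂ hr₂).measure_lt_top.ne
      (measure_mono (Set.image_mono Metric.ball_subset_closedBall))
  have hfrt : f r ≠ ⊤ := ne_top_of_le_ne_top hfr₂ (hmono hrr₂.le)
  suffices h : ∃ W ∈ 𝓝 (1 : G), ∀ B ⊆ W, MeasurableSet B →
      Λ (Metric.ball 0 r) * μ B ≤ κ ^ 2 * (f r * Λ (L '' B)) ∧
      f r * Λ (L '' B) ≤ κ ^ 2 * (Λ (Metric.ball 0 r) * μ B) by
    obtain ⟨W, hW, h⟩ := h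
    -- The constant is the ratio of the Haar and Lebesgue measures of the reference ball.
    refine ⟨f r / Λ (Metric.ball 0 r), ENNReal.div_ne_zero.2 ⟨hfr0, hCt⟩,
      ENNReal.div_ne_top hfrt hC0, W, hW, fun B hB hBm => ?_⟩
    obtain ⟨i1, i2⟩ := h B hB hBm
    have e : ∀ z, f r / Λ (Metric.ball 0 r) * z = (f r * z) / Λ (Metric.ball 0 r) := fun z => by
      rw [div_eq_mul_inv, div_eq_mul_inv]; ring
    rw [e, ← mul_div_assoc, ENNReal.le_div_iff_mul_le (Or.inl hC0) (Or.inl hCt),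
      ENNReal.div_le_iff_le_mul (Or.inl hC0) (Or.inl hCt)]
    exact ⟨by rwa [mul_comm], by rwa [mul_assoc, mul_comm (μ B)]⟩
  refine ⟨N₁⁻¹ ∩ N₂ ∩ P, inter_mem (inter_mem hN₁' hN₂) hP, fun B hB hBm => ?_⟩
  set D : Set G := L.symm '' Metric.ball 0 r₂ with hD
  have hDP : D ⊆ P := by
    rintro _ ⟨v, hv, rfl⟩
    exact (hRt (Metric.ball_subset_closedBall (Metric.ball_subset_ball hr₂ hv))).2
  have hBP : B ⊆ P := fun b hb => (hB hb).2
  have hDf : IsFiniteMeasure (μ.restrict D) := ⟨by simpa using hfr₂.lt_top⟩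
  set T : Set (V × G) := (Metric.ball 0 r ×ˢ Set.univ) ∩
    (fun p : V × G => (L.symm p.1)⁻¹ * p.2) ⁻¹' B with hT
  have hTm : MeasurableSet T := by
    refine ContinuousOn.measurableSet_inter_preimage ?_
      (Metric.isOpen_ball.prod isOpen_univ).measurableSet hBm
    exact ((L.continuousOn_symm.comp continuousOn_fst fun p hp => hball r hrR hp.1).inv).mul
      continuousOn_snd
  have hT1 : (Λ.prod (μ.restrict D)) T = Λ (Metric.ball 0 r) * μ B := by
    rw [Measure.prod_apply hTm]
    have : ∀ x, (μ.restrict D) (Prod.mk x ⁻¹' T) =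
        (Metric.ball (0 : V) r).indicator (fun _ => μ B) x := by
      intro x
      by_cases hx : x ∈ Metric.ball (0 : V) r
      · have hset : Prod.mk x ⁻¹' T = (fun y => (L.symm x)⁻¹ * y) ⁻¹' B := by
          ext y; simp only [hT, Set.mem_preimage, Set.mem_inter_iff, Set.mem_prod, Set.mem_univ,
            hx, true_and, and_true]
        rw [Set.indicator_of_mem hx, hset, Measure.restrict_eq_self, measure_preimage_mul]
        intro y hy
        -- The whole translate of `B` lies in `D`, so restricting `μ` to `D` loses nothing.
        have := hN₂s (Set.mul_mem_mul (Set.mem_image_of_mem L.symm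
          (Metric.ball_subset_closedBall hx)) (hB hy).1.2)
        simpa using this
      · have hset : Prod.mk x ⁻¹' T = ∅ := by
          ext y; simp only [hT, Set.mem_preimage, Set.mem_inter_iff, Set.mem_prod, hx, false_and,
            Set.mem_empty_iff_false]
        rw [Set.indicator_of_notMem hx, hset, measure_empty]
    simp_rw [this]
    rw [lintegral_indicator_const Metric.isOpen_ball.measurableSet, mul_comm]
  rw [← hT1, Measure.prod_apply_symm hTm]
  constructor
  · calc ∫⁻ y, Λ ((fun x => (x, y)) ⁻¹' T) ∂μ.restrict D
        ≤ ∫⁻ y in D, κ * Λ (L '' B) ∂μ := by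
          refine setLIntegral_mono' (hopen r₂ hr₂).measurableSet fun y hy => ?_
          refine (measure_mono ?_).trans (hPκ y (hDP hy) B hBP).1
          rintro x ⟨⟨hx, -⟩, hxB⟩
          refine ⟨_, ⟨_, hxB, rfl⟩, ?_⟩
          simpa using L.right_inv (hball r hrR hx)
      _ = κ * Λ (L '' B) * f r₂ := by rw [setLIntegral_const]
      _ ≤ κ * Λ (L '' B) * (κ * f r) := by gcongr
      _ = _ := by ring
  · calc f r * Λ (L '' B) ≤ (κ * f r₁) * Λ (L '' B) := by gcongr
      _ = κ * ∫⁻ y in L.symm '' Metric.ball 0 r₁, Λ (L '' B) ∂μ := by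
          rw [setLIntegral_const]; ring
      _ ≤ κ * ∫⁻ y in L.symm '' Metric.ball 0 r₁, κ * Λ ((fun x => (x, y)) ⁻¹' T) ∂μ := by
          refine mul_le_mul_right (setLIntegral_mono' (hopen r₁ hr₁R).measurableSet fun y hy => ?_) _
          have hyD : y ∈ D := Set.image_mono (Metric.ball_subset_ball (hr₁r.trans hrr₂).le) hy
          refine (hPκ y (hDP hyD) B hBP).2.trans (mul_le_mul_right (measure_mono ?_) _)
          rintro _ ⟨_, ⟨b, hb, rfl⟩, rfl⟩
          -- For `y` in the smaller ball, `y * b⁻¹` stays in the ball of radius `r`, so the slice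
          -- contains all of `L (y B⁻¹)`.
          obtain ⟨v, hv, hvb⟩ := hN₁s (Set.mul_mem_mul
            (Set.image_mono Metric.ball_subset_closedBall hy) (hB hb).1.1)
          have hv' : L (y * b⁻¹) = v := by rw [← hvb, L.right_inv (hball r hrR hv)]
          simp only [hT, Set.mem_preimage, Set.mem_inter_iff, Set.mem_prod, Set.mem_univ, and_true,
            hv']
          exact ⟨hv, by rw [hvb]; simpa using hb⟩
      _ ≤ κ * ∫⁻ y in D, κ * Λ ((fun x => (x, y)) ⁻¹' T) ∂μ := by
          refine mul_le_mul_right (lintegral_mono_set ?_) _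
          exact Set.image_mono (Metric.ball_subset_ball (hr₁r.trans hrr₂).le)
      _ = _ := by
          rw [lintegral_const_mul' _ _ hκ', ← mul_assoc, sq]

/-- A Haar measure is nearly proportional to Lebesgue measure near the identity, in any chart in
which the division is strictly differentiable at the identity. -/
theorem exists_nhds_haar_comparable [IsTopologicalGroup G] [MeasurableSpace G] [BorelSpace G]
    {μ : Measure G} [μ.IsHaarMeasure]
    (h1 : (1 : G) ∈ L.source) (hL1 : L 1 = 0)
    (hL : HasStrictFDerivAt (fun p : V × V => L (L.symm p.1 * (L.symm p.2)⁻¹))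
      (ContinuousLinearMap.fst ℝ V V - ContinuousLinearMap.snd ℝ V V) 0)
    {κ : ℝ≥0∞} (hκ : 1 < κ) (hκ' : κ ≠ ⊤) :
    ∃ c : ℝ≥0∞, c ≠ 0 ∧ c ≠ ⊤ ∧ ∃ W ∈ 𝓝 (1 : G), ∀ A ⊆ W,
      μ A ≤ κ * (c * Λ (L '' A)) ∧ c * Λ (L '' A) ≤ κ * μ A := by
  -- The measurable case loses a square, hence the square root `m` of `κ`. Arbitrary sets are then
  -- handled by measurable hulls, taken in `V` for the first bound and in `G` for the second.
  obtain ⟨m, hm, hm', rfl⟩ := ENNReal.exists_one_lt_sq_le hκ hκ'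
  obtain ⟨c, hc, hc', W, hW, h⟩ :=
    exists_nhds_haar_comparable_measurableSet (μ := μ) (Λ := Λ) h1 hL1 hL hm hm'
  refine ⟨c, hc, hc', interior W ∩ L.source,
    inter_mem (interior_mem_nhds.2 hW) (L.open_source.mem_nhds h1), fun A hA => ⟨?_, ?_⟩⟩
  · have hB : MeasurableSet ((interior W ∩ L.source) ∩ L ⁻¹' toMeasurable Λ (L '' A)) :=
      ContinuousOn.measurableSet_inter_preimage (L.continuousOn.mono Set.inter_subset_right)
        (isOpen_interior.inter L.open_source).measurableSet (measurableSet_toMeasurable _ _)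
    calc μ A ≤ μ ((interior W ∩ L.source) ∩ L ⁻¹' toMeasurable Λ (L '' A)) :=
          measure_mono fun x hx => ⟨hA hx, subset_toMeasurable _ _ ⟨x, hx, rfl⟩⟩
      _ ≤ m ^ 2 * (c * Λ (L '' ((interior W ∩ L.source) ∩ L ⁻¹' toMeasurable Λ (L '' A)))) :=
          (h _ (fun x hx => interior_subset hx.1.1) hB).1
      _ ≤ m ^ 2 * (c * Λ (toMeasurable Λ (L '' A))) := by
          gcongr
          rintro _ ⟨x, hx, rfl⟩
          exact hx.2
      _ = _ := by rw [measure_toMeasurable]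
  · calc c * Λ (L '' A) ≤ c * Λ (L '' (interior W ∩ toMeasurable μ A)) := by
          gcongr
          exact fun x hx => ⟨(hA hx).1, subset_toMeasurable _ _ hx⟩
      _ ≤ m ^ 2 * μ (interior W ∩ toMeasurable μ A) :=
          (h _ (fun x hx => interior_subset hx.1)
            (isOpen_interior.measurableSet.inter (measurableSet_toMeasurable _ _))).2
      _ ≤ m ^ 2 * μ (toMeasurable μ A) := by gcongr; exact Set.inter_subset_right
      _ = _ := by rw [measure_toMeasurable]

end MeasureComparison

/-! ### Koenigs linearization of a contraction with derivative `1/2`. -/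

section Linearization

variable {E : Type*} [NormedAddCommGroup E] [NormedSpace ℝ E]

/-- The derivative of a `C^2` map is locally Lipschitz, so on a ball of radius `r` it differs from
`A` by at most `C * r`. This linear gain in `r` makes the later series converge. -/
theorem ContDiffAt.exists_norm_sub_sub_le {ψ : E → E} {A : E →L[ℝ] E} (hψ : ContDiffAt ℝ 2 ψ 0)
    (hA : HasFDerivAt ψ A 0) : ∃ C : ℝ, 0 ≤ C ∧ ∃ ρ > 0, ∀ r ≤ ρ, ∀ x ∈ Metric.ball (0 : E) r,
      ∀ y ∈ Metric.ball (0 : E) r, ‖ψ x - ψ y - A (x - y)‖ ≤ C * r * ‖x - y‖ := by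
  obtain ⟨K, t, ht, hK⟩ := (hψ.fderiv_right (m := 1) (by norm_num)).exists_lipschitzOnWith
  have hd : ∀ᶠ x in 𝓝 (0 : E), DifferentiableAt ℝ ψ x :=
    (hψ.eventually (by simp)).mono fun x hx => hx.differentiableAt (by simp)
  obtain ⟨ρ, hρ, hρt⟩ := Metric.mem_nhds_iff.1 (inter_mem ht hd)
  refine ⟨K, K.2, ρ, hρ, fun r hr x hx y hy => ?_⟩
  have hsub : Metric.ball (0 : E) r ⊆ Metric.ball 0 ρ := Metric.ball_subset_ball hr
  refine (convex_ball (0 : E) r).norm_image_sub_le_of_norm_hasFDerivWithin_le' (f' := fderiv ℝ ψ)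
    (fun z hz => (hρt (hsub hz)).2.hasFDerivAt.hasFDerivWithinAt) (fun z hz => ?_) hy hx
  have := hK.norm_sub_le (hρt (hsub hz)).1 (mem_of_mem_nhds ht)
  rw [hA.fderiv, sub_zero] at this
  exact this.trans (mul_le_mul_of_nonneg_left (mem_ball_zero_iff.1 hz).le K.2)

variable {ψ : E → E} {C r : ℝ}

/-- One step contracts by `1/2 + C * r ≤ 1/2 + 1/12 < 2/3`. -/
theorem norm_iterate_le_of_norm_sub_sub_half_le (h0 : ψ 0 = 0) (hCr : 12 * C * r ≤ 1)
    (h : ∀ x ∈ Metric.ball (0 : E) r, ‖ψ x - ψ 0 - (2⁻¹ : ℝ) • (x - 0)‖ ≤ C * r * ‖x - 0‖)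
    {x : E} (hx : x ∈ Metric.ball (0 : E) r) (n : ℕ) : ‖ψ^[n] x‖ ≤ (2 / 3) ^ n * ‖x‖ := by
  induction n with
  | zero => simp
  | succ n ih =>
    have hmem : ψ^[n] x ∈ Metric.ball (0 : E) r := by
      rw [mem_ball_zero_iff] at hx ⊢
      refine (ih.trans ?_).trans_lt hx
      exact mul_le_of_le_one_left (norm_nonneg _) (pow_le_one₀ (by norm_num) (by norm_num))
    have h1 := h _ hmem
    rw [h0, sub_zero, sub_zero] at h1
    rw [Function.iterate_succ_apply']
    have h2 : ‖ψ (ψ^[n] x)‖ ≤ C * r * ‖ψ^[n] x‖ + 2⁻¹ * ‖ψ^[n] x‖ := by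
      calc ‖ψ (ψ^[n] x)‖ = ‖(ψ (ψ^[n] x) - (2⁻¹ : ℝ) • ψ^[n] x) + (2⁻¹ : ℝ) • ψ^[n] x‖ := by
            rw [sub_add_cancel]
        _ ≤ _ := (norm_add_le _ _).trans (add_le_add h1 (by rw [norm_smul]; norm_num))
    rw [pow_succ]
    nlinarith [norm_nonneg (ψ^[n] x)]

/-- The `n`-th iterates lie in a ball of radius `(2/3) ^ n * r`, so the relative error of step `n`
decays geometrically. The two bounds feed each other: the first keeps the rescaled difference below
`2 * ‖x - y‖`, giving the second, and summing `4 * (2/3) ^ n` gives back `12 * (1 - (2/3) ^ n)`. -/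
theorem norm_smul_iterate_sub_le (h0 : ψ 0 = 0) (hC : 0 ≤ C)
    (hCr : 12 * C * r ≤ 1)
    (h : ∀ r' ≤ r, ∀ x ∈ Metric.ball (0 : E) r', ∀ y ∈ Metric.ball (0 : E) r',
      ‖ψ x - ψ y - (2⁻¹ : ℝ) • (x - y)‖ ≤ C * r' * ‖x - y‖)
    {x y : E} (hx : x ∈ Metric.ball (0 : E) r) (hy : y ∈ Metric.ball (0 : E) r) (n : ℕ) :
    ‖(2 : ℝ) ^ n • (ψ^[n] x - ψ^[n] y) - (x - y)‖ ≤ 12 * C * r * (1 - (2 / 3) ^ n) * ‖x - y‖ ∧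
    ‖(2 : ℝ) ^ (n + 1) • (ψ^[n + 1] x - ψ^[n + 1] y) - (2 : ℝ) ^ n • (ψ^[n] x - ψ^[n] y)‖ ≤
      4 * C * r * (2 / 3) ^ n * ‖x - y‖ := by
  have hr : 0 < r := Metric.pos_of_mem_ball hx
  have hball : ∀ z ∈ Metric.ball (0 : E) r, ∀ n, ψ^[n] z ∈ Metric.ball (0 : E) ((2 / 3) ^ n * r) := by
    intro z hz n
    rw [mem_ball_zero_iff]
    refine (norm_iterate_le_of_norm_sub_sub_half_le h0 hCr (fun x hx => h r le_rfl x hx 0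
      (Metric.mem_ball_self hr)) hz n).trans_lt ?_
    exact mul_lt_mul_of_pos_left (mem_ball_zero_iff.1 hz) (by positivity)
  have hq : ∀ n : ℕ, ((2 : ℝ) / 3) ^ n ≤ 1 := fun n => pow_le_one₀ (by norm_num) (by norm_num)
  have hq0 : ∀ n : ℕ, 0 < ((2 : ℝ) / 3) ^ n := fun n => by positivity
  have step : ∀ n, ‖(2 : ℝ) ^ n • (ψ^[n] x - ψ^[n] y) - (x - y)‖ ≤
      12 * C * r * (1 - (2 / 3) ^ n) * ‖x - y‖ →
      ‖(2 : ℝ) ^ (n + 1) • (ψ^[n + 1] x - ψ^[n + 1] y) - (2 : ℝ) ^ n • (ψ^[n] x - ψ^[n] y)‖ ≤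
      4 * C * r * (2 / 3) ^ n * ‖x - y‖ := by
    intro n hn
    have h1 := h ((2 / 3) ^ n * r) (mul_le_of_le_one_left hr.le (hq n)) _ (hball x hx n) _
      (hball y hy n)
    have h2 : ‖(2 : ℝ) ^ n • (ψ^[n] x - ψ^[n] y)‖ ≤ 2 * ‖x - y‖ := by
      have h3 : 12 * C * r * (1 - (2 / 3) ^ n) * ‖x - y‖ ≤ 1 * ‖x - y‖ := by
        refine mul_le_mul_of_nonneg_right ?_ (norm_nonneg _)
        refine mul_le_one₀ hCr (by linarith [hq n]) (by linarith [hq0 n])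
      calc _ = ‖((2 : ℝ) ^ n • (ψ^[n] x - ψ^[n] y) - (x - y)) + (x - y)‖ := by rw [sub_add_cancel]
        _ ≤ _ := (norm_add_le _ _).trans (by linarith)
    have h4 : (2 : ℝ) ^ (n + 1) • (ψ^[n + 1] x - ψ^[n + 1] y) - (2 : ℝ) ^ n • (ψ^[n] x - ψ^[n] y) =
        (2 : ℝ) ^ (n + 1) • (ψ (ψ^[n] x) - ψ (ψ^[n] y) - (2⁻¹ : ℝ) • (ψ^[n] x - ψ^[n] y)) := by
      rw [Function.iterate_succ_apply', Function.iterate_succ_apply', smul_sub _ _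
        ((2⁻¹ : ℝ) • _), smul_smul, pow_succ, mul_inv_cancel_right₀ (two_ne_zero' ℝ)]
    rw [norm_smul, Real.norm_of_nonneg (by positivity)] at h2
    rw [h4, norm_smul, Real.norm_of_nonneg (by positivity)]
    calc (2 : ℝ) ^ (n + 1) * ‖ψ (ψ^[n] x) - ψ (ψ^[n] y) - (2⁻¹ : ℝ) • (ψ^[n] x - ψ^[n] y)‖
        ≤ 2 ^ (n + 1) * (C * ((2 / 3) ^ n * r) * ‖ψ^[n] x - ψ^[n] y‖) := by gcongr
      _ = (2 * C * r * (2 / 3) ^ n) * (2 ^ n * ‖ψ^[n] x - ψ^[n] y‖) := by rw [pow_succ]; ring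
      _ ≤ (2 * C * r * (2 / 3) ^ n) * (2 * ‖x - y‖) := by gcongr
      _ = _ := by ring
  have main : ∀ n, ‖(2 : ℝ) ^ n • (ψ^[n] x - ψ^[n] y) - (x - y)‖ ≤
      12 * C * r * (1 - (2 / 3) ^ n) * ‖x - y‖ := by
    intro n
    induction n with
    | zero => simp
    | succ n ih =>
      calc _ = ‖((2 : ℝ) ^ (n + 1) • (ψ^[n + 1] x - ψ^[n + 1] y) -
            (2 : ℝ) ^ n • (ψ^[n] x - ψ^[n] y)) +
            ((2 : ℝ) ^ n • (ψ^[n] x - ψ^[n] y) - (x - y))‖ := by rw [sub_add_sub_cancel]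
        _ ≤ _ := norm_add_le _ _
        _ ≤ _ := add_le_add (step n ih) ih
        _ = _ := by rw [pow_succ]; ring
  exact ⟨main n, step n (main n)⟩

/-- Koenigs linearization: a `C^2` map with derivative `1/2` at the fixed point `0` is linearized by
a map with derivative `1`. The linearization turns maps that commute with the given one into their
derivatives. -/
theorem exists_linearization [CompleteSpace E] (h0 : ψ 0 = 0) (hψ : ContDiffAt ℝ 2 ψ 0)
    (hd : HasFDerivAt ψ ((2⁻¹ : ℝ) • ContinuousLinearMap.id ℝ E) 0) :
    ∃ σ : E → E, σ 0 = 0 ∧ HasStrictFDerivAt σ (ContinuousLinearMap.id ℝ E) 0 ∧ ∃ ρ > 0,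
      ∀ (τ : E → E) (T : E →L[ℝ] E), τ 0 = 0 → HasFDerivAt τ T 0 → ∀ ρ₁ ≤ ρ,
        (∀ z ∈ Metric.ball (0 : E) ρ₁, τ (ψ z) = ψ (τ z)) →
        ∀ x ∈ Metric.ball (0 : E) ρ₁, τ x ∈ Metric.ball (0 : E) ρ → σ (τ x) = T (σ x) := by
  obtain ⟨C, hC, ρ₀, hρ₀, hbound⟩ := hψ.exists_norm_sub_sub_le hd
  simp only [smul_apply, ContinuousLinearMap.id_apply] at hbound
  obtain ⟨ρ, hρ, hρρ₀, hCρ⟩ : ∃ ρ > 0, ρ ≤ ρ₀ ∧ 12 * C * ρ ≤ 1 := by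
    refine ⟨min ρ₀ (1 / (12 * C + 1)), by positivity, min_le_left _ _, ?_⟩
    calc 12 * C * min ρ₀ (1 / (12 * C + 1)) ≤ (12 * C + 1) * (1 / (12 * C + 1)) := by
          gcongr
          · linarith
          · exact min_le_right _ _
      _ = 1 := by field_simp
  have hCr : ∀ r ≤ ρ, 12 * C * r ≤ 1 := fun r hr =>
    (mul_le_mul_of_nonneg_left hr (by positivity)).trans hCρ
  have hest : ∀ r ≤ ρ, ∀ x ∈ Metric.ball (0 : E) r, ∀ y ∈ Metric.ball (0 : E) r, ∀ n : ℕ, _ :=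
    fun r hr x hx y hy n => norm_smul_iterate_sub_le h0 hC (hCr r hr)
      (fun r' hr' => hbound r' (hr'.trans (hr.trans hρρ₀))) hx hy n
  have hfix : ∀ n, ψ^[n] 0 = 0 := fun n => Function.iterate_fixed h0 n
  have hlim : ∀ x ∈ Metric.ball (0 : E) ρ, ∃ l,
      Tendsto (fun n => (2 : ℝ) ^ n • ψ^[n] x) atTop (𝓝 l) := by
    intro x hx
    refine cauchySeq_tendsto_of_complete (cauchySeq_of_le_geometric (2 / 3) (4 * C * ρ * ‖x‖)
      (by norm_num) fun n => ?_)
    have := (hest ρ le_rfl x hx 0 (Metric.mem_ball_self hρ) n).2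
    rw [hfix, hfix, sub_zero, sub_zero, sub_zero] at this
    rw [dist_eq_norm, norm_sub_rev]
    exact this.trans_eq (by ring)
  choose! σ hσ using hlim
  have hσ0 : σ 0 = 0 := tendsto_nhds_unique (hσ 0 (Metric.mem_ball_self hρ)) (by simp [hfix])
  refine ⟨σ, hσ0, ?_, ρ, hρ, ?_⟩
  · have hσest : ∀ r ≤ ρ, ∀ x ∈ Metric.ball (0 : E) r, ∀ y ∈ Metric.ball (0 : E) r,
        ‖σ x - σ y - (x - y)‖ ≤ 12 * C * r * ‖x - y‖ := by
      intro r hr x hx y hy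
      have hr0 : 0 < r := Metric.pos_of_mem_ball hx
      have hsub := Metric.ball_subset_ball (x := (0 : E)) hr
      refine le_of_tendsto ((((hσ x (hsub hx)).sub (hσ y (hsub hy))).sub_const (x - y)).norm)
        (Eventually.of_forall fun n => ?_)
      have := (hest r hr x hx y hy n).1
      rw [smul_sub] at this
      refine this.trans ?_
      refine mul_le_mul_of_nonneg_right (mul_le_of_le_one_right (by positivity) ?_) (norm_nonneg _)
      exact sub_le_self _ (by positivity)
    rw [hasStrictFDerivAt_iff_isLittleO, Asymptotics.isLittleO_iff]
    intro c hc
    have hr : 0 < min ρ (c / (12 * C + 1)) := by positivity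
    have hmem := prod_mem_nhds (Metric.ball_mem_nhds (0 : E) hr) (Metric.ball_mem_nhds (0 : E) hr)
    filter_upwards [hmem] with p hp
    refine (hσest _ (min_le_left _ _) p.1 hp.1 p.2 hp.2).trans ?_
    gcongr
    calc 12 * C * min ρ (c / (12 * C + 1)) ≤ (12 * C + 1) * (c / (12 * C + 1)) := by
          gcongr
          · linarith
          · exact min_le_right _ _
      _ = c := by field_simp
  · intro τ T hτ0 hτ ρ₁ hρ₁ hcomm x hx hτx
    have hxρ := Metric.ball_subset_ball hρ₁ hx
    have hnorm : ∀ n, ‖ψ^[n] x‖ ≤ (2 / 3) ^ n * ‖x‖ := norm_iterate_le_of_norm_sub_sub_half_le h0 hCρ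
      (fun z hz => hbound ρ hρρ₀ z hz 0 (Metric.mem_ball_self hρ)) hxρ
    have hmem : ∀ n, ψ^[n] x ∈ Metric.ball (0 : E) ρ₁ := fun n => by
      rw [mem_ball_zero_iff] at hx ⊢
      refine (hnorm n).trans_lt (lt_of_le_of_lt ?_ hx)
      exact mul_le_of_le_one_left (norm_nonneg _) (pow_le_one₀ (by norm_num) (by norm_num))
    have hiter : ∀ n, ψ^[n] (τ x) = τ (ψ^[n] x) := by
      intro n
      induction n with
      | zero => rfl
      | succ n ih =>
        rw [Function.iterate_succ_apply', Function.iterate_succ_apply', ih, hcomm _ (hmem n)]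
    have hzero : Tendsto (fun n => ψ^[n] x) atTop (𝓝 0) := by
      refine squeeze_zero_norm hnorm ?_
      simpa using (tendsto_pow_atTop_nhds_zero_of_lt_one (r := (2 / 3 : ℝ)) (by norm_num)
        (by norm_num)).mul_const ‖x‖
    refine tendsto_nhds_unique (hσ _ hτx) ?_
    simp_rw [hiter]
    -- Since `ψ^[n] x → 0` and `2 ^ n • ψ^[n] x → σ x`, differentiability of `τ` at `0` gives `2 ^ n
    -- • τ (ψ^[n] x) → T (σ x)`.
    have := hτ.hasFDerivWithinAt (s := Set.univ) |>.lim hzero (by simp) (hσ x hxρ)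
    simpa [hτ0] using this

end Linearization

/-! ### A logarithm chart from the local square root. -/

section LocalLog

variable {G : Type*} [Group G] [TopologicalSpace G]
  {E : Type*} [NormedAddCommGroup E] [NormedSpace ℝ E] {φ : OpenPartialHomeomorph G E}

/-- The derivative is fixed by its values on `(v, 0)`, from `x * 1⁻¹ = x`, and on the diagonal, from
`x * x⁻¹ = 1`. -/
theorem OpenPartialHomeomorph.hasStrictFDerivAt_mul_inv_of_contDiffAt (h1 : (1 : G) ∈ φ.source)
    (hφ1 : φ 1 = 0)
    (hφ : ContDiffAt ℝ 2 (fun p : E × E => φ (φ.symm p.1 * (φ.symm p.2)⁻¹)) 0) :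
    HasStrictFDerivAt (fun p : E × E => φ (φ.symm p.1 * (φ.symm p.2)⁻¹))
      (ContinuousLinearMap.fst ℝ E E - ContinuousLinearMap.snd ℝ E E) 0 := by
  have h0 : (0 : E) ∈ φ.target := hφ1 ▸ φ.map_source h1
  have hs : φ.symm 0 = 1 := by rw [← hφ1, φ.left_inv h1]
  have hD := hφ.hasStrictFDerivAt (by simp)
  set D := fderiv ℝ (fun p : E × E => φ (φ.symm p.1 * (φ.symm p.2)⁻¹)) 0 with hDdef
  have hl : ∀ v, D (v, 0) = v := by
    have e1 : HasFDerivAt (fun v : E => φ (φ.symm v * (φ.symm (0 : E))⁻¹))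
        (D.comp (ContinuousLinearMap.inl ℝ E E)) 0 := by
      refine HasFDerivAt.comp (0 : E) (g := fun p : E × E => φ (φ.symm p.1 * (φ.symm p.2)⁻¹))
        (f := fun v : E => (v, (0 : E))) hD.hasFDerivAt
        (ContinuousLinearMap.inl ℝ E E).hasFDerivAt
    have e2 : HasFDerivAt (fun v : E => φ (φ.symm v * (φ.symm (0 : E))⁻¹))
        (ContinuousLinearMap.id ℝ E) 0 := by
      refine (hasFDerivAt_id (0 : E)).congr_of_eventuallyEq ?_
      filter_upwards [φ.open_target.mem_nhds h0] with v hv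
      rw [hs, inv_one, mul_one, φ.right_inv hv, id]
    intro v
    simpa using congrArg (fun A : E →L[ℝ] E => A v) (e1.unique e2)
  have hd : ∀ v, D (v, v) = 0 := by
    have e1 : HasFDerivAt (fun v : E => φ (φ.symm v * (φ.symm v)⁻¹))
        (D.comp ((ContinuousLinearMap.id ℝ E).prod (ContinuousLinearMap.id ℝ E))) 0 := by
      refine HasFDerivAt.comp (0 : E) (g := fun p : E × E => φ (φ.symm p.1 * (φ.symm p.2)⁻¹))
        (f := fun v : E => (v, v)) hD.hasFDerivAt
        ((ContinuousLinearMap.id ℝ E).prod (ContinuousLinearMap.id ℝ E)).hasFDerivAt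
    have e2 : HasFDerivAt (fun v : E => φ (φ.symm v * (φ.symm v)⁻¹)) (0 : E →L[ℝ] E) 0 := by
      simp only [mul_inv_cancel]
      exact hasFDerivAt_const _ _
    intro v
    simpa using congrArg (fun A : E →L[ℝ] E => A v) (e1.unique e2)
  refine hD.congr_fderiv (ContinuousLinearMap.ext ?_)
  rintro ⟨v, w⟩
  have : ((v, w) : E × E) = (v - w, 0) + (w, w) := by simp
  rw [this, map_add D, hl, hd]
  simp

/-- A logarithm: near the identity there are coordinates which turn endomorphisms and
antiendomorphisms of the group into linear maps. -/
theorem exists_linearizing_chart [IsTopologicalGroup G] [FiniteDimensional ℝ E]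
    (h1 : (1 : G) ∈ φ.source) (hφ1 : φ 1 = 0)
    (hφ : ContDiffAt ℝ 2 (fun p : E × E => φ (φ.symm p.1 * (φ.symm p.2)⁻¹)) 0) :
    ∃ L : OpenPartialHomeomorph G E, (1 : G) ∈ L.source ∧ L 1 = 0 ∧
      HasStrictFDerivAt (fun p : E × E => L (L.symm p.1 * (L.symm p.2)⁻¹))
        (ContinuousLinearMap.fst ℝ E E - ContinuousLinearMap.snd ℝ E E) 0 ∧
      ∀ (S : Set G) (a : G → G → G) (T : G → E →L[ℝ] E),
        (∀ g ∈ S, a g 1 = 1) → (∀ g ∈ S, ∀ x, a g (x * x) = a g x * a g x) →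
        (∀ N ∈ 𝓝 (1 : G), ∀ᶠ x in 𝓝 (1 : G), ∀ g ∈ S, a g x ∈ N) →
        (∀ g ∈ S, HasFDerivAt (fun v => φ (a g (φ.symm v))) (T g) 0) →
        ∀ᶠ x in 𝓝 (1 : G), ∀ g ∈ S, L (a g x) = T g (L x) := by
  have : CompleteSpace E := FiniteDimensional.complete ℝ E
  have h0 : (0 : E) ∈ φ.target := hφ1 ▸ φ.map_source h1
  have hs0 : φ.symm 0 = 1 := by rw [← hφ1, φ.left_inv h1]
  have hsymm : Tendsto φ.symm (𝓝 0) (𝓝 1) := hs0 ▸ φ.continuousAt_symm h0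
  have hφt : Tendsto φ (𝓝 1) (𝓝 0) := hφ1 ▸ φ.continuousAt h1
  have hsrc : φ.source ∈ 𝓝 (1 : G) := φ.open_source.mem_nhds h1
  have hH := φ.hasStrictFDerivAt_mul_inv_of_contDiffAt h1 hφ1 hφ
  have hinv1 : Tendsto (fun x : G => x⁻¹) (𝓝 1) (𝓝 1) := by
    simpa using (continuous_inv (G := G)).tendsto 1
  have hmul1 : Tendsto (fun x : G => x * x) (𝓝 1) (𝓝 1) := by
    simpa using (show Continuous fun x : G => x * x by fun_prop).tendsto 1
  -- the square in the chart
  let s : E → E := fun v => φ (φ.symm v * φ.symm v)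
  have hs00 : s 0 = 0 := by simp [s, hs0, hφ1]
  -- Only division is assumed smooth, so squaring is written as `x * (1 * x⁻¹)⁻¹`.
  let i : E → E := fun v => φ (φ.symm 0 * (φ.symm v)⁻¹)
  have hi0 : i 0 = 0 := by simp [i, hs0, hφ1]
  have hsi : s =ᶠ[𝓝 0] (fun p : E × E => φ (φ.symm p.1 * (φ.symm p.2)⁻¹)) ∘ fun v => (v, i v) := by
    filter_upwards [hsymm (hinv1 hsrc)] with v hv
    simp only [s, i, Function.comp_apply, hs0, one_mul]
    rw [φ.left_inv hv, inv_inv]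
  have hic : ContDiffAt ℝ 2 i 0 :=
    ContDiffAt.comp (0 : E) (g := fun p : E × E => φ (φ.symm p.1 * (φ.symm p.2)⁻¹))
      (f := fun v : E => ((0 : E), v)) hφ (contDiffAt_const.prodMk contDiffAt_id)
  have hid : HasFDerivAt i (-ContinuousLinearMap.id ℝ E) 0 := by
    have := HasFDerivAt.comp (0 : E) (g := fun p : E × E => φ (φ.symm p.1 * (φ.symm p.2)⁻¹))
      (f := fun v : E => ((0 : E), v)) hH.hasFDerivAt (ContinuousLinearMap.inr ℝ E E).hasFDerivAt
    exact this.congr_fderiv (by ext; simp)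
  have hsc : ContDiffAt ℝ 2 s 0 := by
    refine ContDiffAt.congr_of_eventuallyEq (ContDiffAt.comp (0 : E) ?_
      (contDiffAt_id.prodMk hic)) hsi
    rwa [hi0]
  let A : E ≃L[ℝ] E := ContinuousLinearEquiv.smulLeft (Units.mk0 (2 : ℝ) two_ne_zero)
  have hsd : HasFDerivAt s (A : E →L[ℝ] E) 0 := by
    have : HasFDerivAt ((fun p : E × E => φ (φ.symm p.1 * (φ.symm p.2)⁻¹)) ∘ fun v => (v, i v))
      ((ContinuousLinearMap.fst ℝ E E - ContinuousLinearMap.snd ℝ E E).comp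
        ((ContinuousLinearMap.id ℝ E).prod (-ContinuousLinearMap.id ℝ E))) 0 := by
      refine HasFDerivAt.comp (0 : E) ?_ ((hasFDerivAt_id (0 : E)).prodMk hid)
      rw [hi0]; exact hH.hasFDerivAt
    refine (this.congr_of_eventuallyEq hsi).congr_fderiv ?_
    ext v
    simp [A, two_smul, Units.smul_def]
  have hss := hsc.hasStrictFDerivAt' hsd (by simp)
  -- The local square root in the chart, from the inverse function theorem.
  let ψ := hsc.localInverse hsd (by simp)
  have hψ0 : ψ 0 = 0 := by
    have := hsc.localInverse_apply_image hsd (by simp)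
    rwa [hs00] at this
  have hψc : ContDiffAt ℝ 2 ψ 0 := by
    have := hsc.to_localInverse hsd (by simp)
    rwa [hs00] at this
  have hψd : HasFDerivAt ψ ((2⁻¹ : ℝ) • ContinuousLinearMap.id ℝ E) 0 := by
    have := hss.to_localInverse.hasFDerivAt
    rw [hs00] at this
    refine this.congr_fderiv ?_
    ext v
    exact A.symm_apply_eq.2 (by simp [A, Units.smul_def, smul_smul])
  have hψs : ∀ᶠ v in 𝓝 (0 : E), ψ (s v) = v := hss.eventually_left_inverse
  have hsψ : ∀ᶠ v in 𝓝 (0 : E), s (ψ v) = v := by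
    have := hss.eventually_right_inverse
    rwa [hs00] at this
  have hψt : Tendsto ψ (𝓝 0) (𝓝 0) := by simpa [hψ0] using hψc.continuousAt.tendsto
  obtain ⟨σ, hσ0, hσ, ρ, hρ, hσρ⟩ := exists_linearization hψ0 hψc hψd
  have hσ' : HasStrictFDerivAt σ ((ContinuousLinearEquiv.refl ℝ E : E ≃L[ℝ] E) : E →L[ℝ] E) 0 := hσ
  let e := hσ'.toOpenPartialHomeomorph σ
  have he0 : e.symm 0 = 0 := by
    have := hσ'.localInverse_apply_image
    rwa [hσ0] at this
  refine ⟨φ.trans e, ?_, ?_, ?_, ?_⟩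
  · rw [OpenPartialHomeomorph.trans_source]
    exact ⟨h1, by rw [Set.mem_preimage, hφ1]; exact hσ'.mem_toOpenPartialHomeomorph_source⟩
  · change σ (φ 1) = 0
    rw [hφ1, hσ0]
  · have he : HasStrictFDerivAt e.symm (ContinuousLinearMap.id ℝ E) 0 := by
      have := hσ'.to_localInverse
      rw [hσ0] at this
      exact this
    have e1 : HasStrictFDerivAt (fun p : E × E => (e.symm p.1, e.symm p.2))
        (((ContinuousLinearMap.id ℝ E).comp (ContinuousLinearMap.fst ℝ E E)).prod
          ((ContinuousLinearMap.id ℝ E).comp (ContinuousLinearMap.snd ℝ E E))) 0 :=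
      (HasStrictFDerivAt.comp (0 : E × E) (g := e.symm) he hasStrictFDerivAt_fst).prodMk
        (HasStrictFDerivAt.comp (0 : E × E) (g := e.symm) he hasStrictFDerivAt_snd)
    have e2 := HasStrictFDerivAt.comp (0 : E × E)
      (g := fun p : E × E => φ (φ.symm p.1 * (φ.symm p.2)⁻¹)) (by rw [Prod.fst_zero, Prod.snd_zero, he0]; exact hH) e1
    have e3 := HasStrictFDerivAt.comp (0 : E × E) (g := σ) (by simpa [he0, hs0, hφ1] using hσ) e2
    exact e3.congr_fderiv (by ext <;> simp)
  · intro S a T ha1 hamul hafam haT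
    have hN : φ.source ∩ φ ⁻¹' {v | ψ (s v) = v} ∈ 𝓝 (1 : G) := inter_mem hsrc (hφt hψs)
    have hψ1 : Tendsto (fun v => φ.symm (ψ v)) (𝓝 0) (𝓝 1) := hsymm.comp hψt
    -- Since `a g` preserves squares, it commutes with squaring and hence, near `0`, with the local
    -- square root, uniformly in `g ∈ S`.
    have hcomm : ∀ᶠ z in 𝓝 (0 : E), ∀ g ∈ S,
        φ (a g (φ.symm (ψ z))) = ψ (φ (a g (φ.symm z))) := by
      filter_upwards [hsψ, (hmul1.comp hψ1) hsrc, hψ1.eventually (hafam _ hN)] with z hz hzs hza g hg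
      have hza := hza g hg
      have e1 : φ.symm z = φ.symm (ψ z) * φ.symm (ψ z) := by
        exact (congrArg φ.symm hz.symm).trans (φ.left_inv hzs)
      have e2 : φ (a g (φ.symm z)) = s (φ (a g (φ.symm (ψ z)))) := by
        simp only [s]
        rw [φ.left_inv hza.1, e1, hamul g hg]
      rw [e2]
      exact hza.2.symm
    obtain ⟨ρ₁, hρ₁, hcommρ⟩ := Metric.eventually_nhds_iff_ball.1 hcomm
    have hB : ∀ t > 0, φ ⁻¹' Metric.ball (0 : E) t ∈ 𝓝 (1 : G) :=
      fun t ht => hφt (Metric.ball_mem_nhds 0 ht)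
    filter_upwards [hsrc, hB (min ρ ρ₁) (lt_min hρ hρ₁), hafam _ (hB ρ hρ)] with x hx hxρ hax g hg
    have := hσρ (fun v => φ (a g (φ.symm v))) (T g) (by simp only [hs0, ha1 g hg, hφ1])
      (haT g hg) (min ρ ρ₁) (min_le_left _ _)
      (fun z hz => hcommρ z (Metric.ball_subset_ball (min_le_right _ _) hz) g hg) (φ x) hxρ
      (by rw [φ.left_inv hx]; exact hax g hg)
    simp only [φ.left_inv hx] at this
    exact this

end LocalLog

/-! ### The chart of a Lie group at the identity and the adjoint map. -/

section LieGroup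

variable {E : Type*} [NormedAddCommGroup E] [NormedSpace ℝ E]
  {H : Type*} [TopologicalSpace H] (I : ModelWithCorners ℝ E H) [I.Boundaryless]
  (G : Type*) [Group G] [TopologicalSpace G] [ChartedSpace H G]

/-- The preferred chart at the identity, translated so that it maps the identity to `0`. -/
noncomputable def chartAtOne : OpenPartialHomeomorph G E :=
  ((chartAt H (1 : G)).transHomeomorph I.toHomeomorph).transHomeomorph
    (Homeomorph.subRight (extChartAt I (1 : G) 1))

theorem chartAtOne_apply (x : G) :
    chartAtOne I G x = extChartAt I (1 : G) x - extChartAt I (1 : G) 1 := rfl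

theorem chartAtOne_symm_apply (v : E) :
    (chartAtOne I G).symm v = (extChartAt I (1 : G)).symm (v + extChartAt I (1 : G) 1) := rfl

theorem one_mem_chartAtOne_source : (1 : G) ∈ (chartAtOne I G).source :=
  mem_chart_source H (1 : G)

theorem chartAtOne_one : chartAtOne I G 1 = 0 := by
  rw [chartAtOne_apply, sub_self]

theorem chartAtOne_symm_zero : (chartAtOne I G).symm 0 = 1 := by
  rw [chartAtOne_symm_apply, zero_add, extChartAt_to_inv]

theorem contDiffAt_chartAtOne_mul_inv [LieGroup I ∞ G] :
    ContDiffAt ℝ 2 (fun p : E × E =>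
      chartAtOne I G ((chartAtOne I G).symm p.1 * ((chartAtOne I G).symm p.2)⁻¹)) 0 := by
  have hsymm : ContMDiffAt 𝓘(ℝ, E) I ∞ (chartAtOne I G).symm 0 := by
    have h1 : ContMDiffAt 𝓘(ℝ, E) I ∞ (extChartAt I (1 : G)).symm (0 + extChartAt I (1 : G) 1) := by
      rw [zero_add]
      exact (contMDiffOn_extChartAt_symm (1 : G)).contMDiffAt (extChartAt_target_mem_nhds (1 : G))
    have h2 : ContMDiffAt 𝓘(ℝ, E) 𝓘(ℝ, E) ∞ (fun v => v + extChartAt I (1 : G) 1) 0 :=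
      (contDiff_id.add contDiff_const).contMDiff.contMDiffAt
    exact ContMDiffAt.comp (0 : E) (g := (extChartAt I (1 : G)).symm)
      (f := fun v => v + extChartAt I (1 : G) 1) h1 h2
  have hchart : ContMDiffAt I 𝓘(ℝ, E) ∞ (chartAtOne I G) 1 := by
    have h1 : ContMDiff 𝓘(ℝ, E) 𝓘(ℝ, E) ∞ (fun v => v - extChartAt I (1 : G) 1) :=
      (contDiff_id.sub contDiff_const).contMDiff
    have h2 : ContMDiffAt I 𝓘(ℝ, E) ∞ (extChartAt I (1 : G)) 1 := contMDiffAt_extChartAt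
    exact ContMDiffAt.comp (1 : G) (g := fun v => v - extChartAt I (1 : G) 1)
      (f := extChartAt I (1 : G)) h1.contMDiffAt h2
  have hfst : ContMDiffAt 𝓘(ℝ, E × E) I ∞ (fun p : E × E => (chartAtOne I G).symm p.1) 0 :=
    ContMDiffAt.comp (0 : E × E) (I' := 𝓘(ℝ, E)) hsymm contDiff_fst.contMDiff.contMDiffAt
  have hsnd : ContMDiffAt 𝓘(ℝ, E × E) I ∞ (fun p : E × E => (chartAtOne I G).symm p.2) 0 :=
    ContMDiffAt.comp (0 : E × E) (I' := 𝓘(ℝ, E)) hsymm contDiff_snd.contMDiff.contMDiffAt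
  have hmul := hfst.mul hsnd.inv
  have h : ContMDiffAt 𝓘(ℝ, E × E) 𝓘(ℝ, E) ∞ (fun p : E × E =>
      chartAtOne I G ((chartAtOne I G).symm p.1 * ((chartAtOne I G).symm p.2)⁻¹)) 0 := by
    refine ContMDiffAt.comp (0 : E × E) (I' := I) (g := chartAtOne I G) ?_ hmul
    simpa [chartAtOne_symm_zero] using hchart
  exact h.contDiffAt.of_le (by exact WithTop.coe_le_coe.2 (le_top (a := (2 : ℕ∞))))

theorem hasFDerivAt_chartAtOne_conj [LieGroup I ∞ G] (g : G) :
    HasFDerivAt (fun v => chartAtOne I G (g * (chartAtOne I G).symm v * g⁻¹))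
      (adjointMap I g : E →L[ℝ] E) 0 := by
  have hs : ContMDiff I I ∞ (fun x : G => g * x * g⁻¹) :=
    (contMDiff_mul_right (I := I) (n := ∞) (a := g⁻¹)).comp
      (contMDiff_mul_left (I := I) (n := ∞) (a := g))
  have hd : MDifferentiableAt I I (fun x : G => g * x * g⁻¹) 1 := hs.mdifferentiableAt (by simp)
  have h1 : g * 1 * g⁻¹ = 1 := by simp
  -- Naming the derivative as a plain map `E →L[ℝ] E` removes its dependence on the base point `g *
  -- 1 * g⁻¹`, which can then be rewritten to `1`.
  obtain ⟨A, h2, hA⟩ : ∃ A : E →L[ℝ] E, HasFDerivWithinAt (extChartAt I (g * 1 * g⁻¹) ∘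
      (fun x : G => g * x * g⁻¹) ∘ (extChartAt I (1 : G)).symm) A (Set.range I)
      (extChartAt I (1 : G) 1) ∧ A = (adjointMap I g : E →L[ℝ] E) :=
    ⟨adjointMap I g, hd.hasMFDerivAt.2, rfl⟩
  rw [← hA]
  rw [h1, I.range_eq_univ, hasFDerivWithinAt_univ] at h2
  have h3 : HasFDerivAt (fun v : E => v + extChartAt I (1 : G) 1) (ContinuousLinearMap.id ℝ E) 0 :=
    (hasFDerivAt_id (0 : E)).add_const _
  have h4 := HasFDerivAt.comp (0 : E) (by rwa [zero_add]) h3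
  exact (h4.sub_const (extChartAt I (1 : G) 1))

end LieGroup

/-! ### Uniformity over `F` and conclusion. -/

theorem IsCompact.eventually_forall_conj_mem {G : Type*} [Group G] [TopologicalSpace G]
    [IsTopologicalGroup G] {F : Set G} (hF : IsCompact (closure F)) {N : Set G}
    (hN : N ∈ 𝓝 (1 : G)) : ∀ᶠ x in 𝓝 (1 : G), ∀ g ∈ F, g * x * g⁻¹ ∈ N := by
  have h := hF.eventually_forall_of_forall_eventually (x₀ := (1 : G))
    (P := fun x g => g * x * g⁻¹ ∈ N) fun g _ => by
      have hc : Continuous fun z : G × G => z.2 * z.1 * z.2⁻¹ := by fun_prop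
      exact hc.continuousAt.preimage_mem_nhds (by simpa using hN)
  exact h.mono fun x hx g hg => hx g (subset_closure hg)

theorem groupDelta_eq_repDelta_of_chart {E : Type*} [NormedAddCommGroup E] [NormedSpace ℝ E]
    [FiniteDimensional ℝ E] [MeasurableSpace E] [BorelSpace E]
    {G : Type*} [Group G] [TopologicalSpace G] [IsTopologicalGroup G] [MeasurableSpace G]
    [BorelSpace G] (μ : Measure G) [μ.IsHaarMeasure] (Λ : Measure E) [Λ.IsAddHaarMeasure]
    {F : Set G} (hF : IsCompact (closure F)) (hne : F.Nonempty) {φ : OpenPartialHomeomorph G E}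
    (h1 : (1 : G) ∈ φ.source) (hφ1 : φ 1 = 0)
    (hφ : ContDiffAt ℝ 2 (fun p : E × E => φ (φ.symm p.1 * (φ.symm p.2)⁻¹)) 0)
    (T : G → E →L[ℝ] E) (π : Representation ℝ G E) (hπ : ∀ g v, π g v = T g v)
    (hT : ∀ g, HasFDerivAt (fun v => φ (g * φ.symm v * g⁻¹)) (T g) 0) :
    groupDelta μ F = repDelta Λ π F := by
  obtain ⟨L, hL, hL1, hLd, hequiv⟩ := exists_linearizing_chart h1 hφ1 hφ
  have hs0 : φ.symm 0 = 1 := by rw [← hφ1, φ.left_inv h1]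
  have hinvd : HasFDerivAt (fun v => φ (φ.symm v)⁻¹) (-ContinuousLinearMap.id ℝ E) 0 := by
    have := HasFDerivAt.comp (0 : E) (f := fun v : E => ((0 : E), v))
      (φ.hasStrictFDerivAt_mul_inv_of_contDiffAt h1 hφ1 hφ).hasFDerivAt
      (ContinuousLinearMap.inr ℝ E E).hasFDerivAt
    simp only [Function.comp_def, hs0, one_mul] at this
    exact this.congr_fderiv (by ext; simp)
  refine groupDelta_eq_repDelta_of_openPartialHomeomorph hne L hL hL1 ?_
    (fun N hN => hF.eventually_forall_conj_mem hN) ?_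
    fun κ hκ hκ' => exists_nhds_haar_comparable hL hL1 hLd hκ hκ'
  -- Inversion is an antiendomorphism but still preserves squares; its derivative `-id` makes `L`
  -- odd.
  · refine (hequiv {1} (fun _ x => x⁻¹) (fun _ => -ContinuousLinearMap.id ℝ E) (by simp) (by simp)
      (fun N hN => ?_) fun _ _ => hinvd).mono fun x hx => by simpa using hx 1 rfl
    filter_upwards [inv_mem_nhds_one G hN] with x hx _ _ using hx
  · refine (hequiv F (fun g x => g * x * g⁻¹) T (by simp) (fun g _ x => by group)
      (fun N hN => hF.eventually_forall_conj_mem hN) fun g _ => hT g).mono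
      fun x hx g hg => by rw [hπ, hx g hg]

theorem mainTheorem7
    {E : Type*} [NormedAddCommGroup E] [NormedSpace ℝ E] [FiniteDimensional ℝ E]
    {H : Type*} [TopologicalSpace H] (I : ModelWithCorners ℝ E H) [I.Boundaryless]
    {G : Type*} [Group G] [TopologicalSpace G] [ChartedSpace H G] [LieGroup I ∞ G]
    [MeasurableSpace G] [BorelSpace G] (μ : Measure G) [μ.IsHaarMeasure]
    [MeasurableSpace (GroupLieAlgebra I G)] [BorelSpace (GroupLieAlgebra I G)]
    (Λ : Measure (GroupLieAlgebra I G)) [Λ.IsAddHaarMeasure]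
    (F : Set G) (hF : IsCompact (closure F)) (hne : F.Nonempty) :
    groupDelta μ F = repDelta Λ (adjointRep I) F := by
  have := topologicalGroup_of_lieGroup I ∞ (G := G)
  -- `GroupLieAlgebra I G` unfolds to `E`; the measure structure is restated there so that the chart
  -- version applies.
  let mE : MeasurableSpace E := ‹MeasurableSpace (GroupLieAlgebra I G)›
  have bE : BorelSpace E := ‹BorelSpace (GroupLieAlgebra I G)›
  have hΛ : @Measure.IsAddHaarMeasure E _ _ mE Λ := ‹Λ.IsAddHaarMeasure›
  exact groupDelta_eq_repDelta_of_chart (E := E) μ Λ hF hne (one_mem_chartAtOne_source I G)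
    (chartAtOne_one I G) (contDiffAt_chartAtOne_mul_inv I G) (fun g => adjointMap I g)
    (adjointRep I) (fun _ _ => rfl) (hasFDerivAt_chartAtOne_conj I G)
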